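/- Let $G=(V,E)$ be a finite directed acyclic graph in which every node $v\in V$ carries a finite set $\mathrm{Val}_v$ of at least two values; write $\mathrm{pa}(v)$ for the set of parents of $v$, and $\mathrm{Val}_W=\prod_{w\in W}\mathrm{Val}_w$ for $W\subseteq V$. *The factored space model of $G$.* Let $I=\{(v,x): v\in V,\ x\in \mathrm{Val}_{\mathrm{pa}(v)}\}$, let $\Omega_{(v,x)}=\mathrm{Val}_v$ for $(v,x)\in I$, and let $\Omega=\prod_{i\in I}\Omega_i$. The node variables $X_v:\Omega\to\mathrm{Val}_v$ are defined recursively along $G$ by $X_v(\omega)=\omega_{(v,\,X_{\mathrm{pa}(v)}(\omega))}$, where $X_W=(X_w)_{w\in W}:\Omega\to\mathrm{Val}_W$ for $W\subseteq V$. *Structural independence.* For $J\subseteq I$ and $C\subseteq\Omega$, let $\omega_J=(\omega_j)_{j\in J}$ and $C_J=\{\omega_J:\omega\in C\}$. The set $J$ generates a function $X$ on $\Omega$ given $C$ if $X(\omega)$ is a function of $\omega_J$ for $\omega\in C$, and $C=C_J\times C_{I\setminus J}$. The history $\mathcal H(X\mid C)\subseteq I$ is the intersection of all $J\subseteq I$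 that generate $X$ given $C$. Functions $X$ and $Y$ on $\Omega$ are structurally independent given a function $Z$ on $\Omega$ if $\mathcal H(X\mid Z=z)\cap\mathcal H(Y\mid Z=z)=\varnothing$ for every value $z$ of $Z$. *d-separation.* For $V_1,V_2,V_3\subseteq V$ (not necessarily disjoint), $V_1$ and $V_2$ are d-separated given $V_3$ in $G$ if every path without repeated nodes in the undirected graph underlying $G$ (possibly with zero edges) from a node of $V_1$ to a node of $V_2$ is blocked by $V_3$. A path is blocked by $V_3$ if some node on it that is not a collider of the path (end points are not colliders) lies in $V_3$, or if some collider of the path (an inner node towards which both adjacent edges of the path point) neither lies in $V_3$ nor has a descendant in $V_3$. **Proposition.** For all $V_1,V_2,V_3\subseteq V$, the sets $V_1$ and $V_2$ are d-separated given $V_3$ in $G$ if and only if $X_{V_1}$ and $X_{V_2}$ are structurally independent given $X_{V_3}$. -/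

import Mathlib

/-! ### Factored spaces, history and structural independence

A factored space is a Cartesian product `∀ i, Ω i` over an index type `I`; an event is a set of
points and a random variable is a function on the space. For `J : Set I`, the projection to `J` is
`J.domRestrict`. -/

namespace FactoredSpace

/-- `Y` is derived from `X` on the event `C`: it is a deterministic function of `X` on `C`. -/
def IsDerivedOn {S α β : Type*} (X : S → α) (Y : S → β) (C : Set S) : Prop :=
  ∃ f : α → β, ∀ ω ∈ C, Y ω = f (X ω)

variable {I : Type*} {Ω : I → Type*}

open Classical in
/-- The merge of a family indexed by `J` and a family indexed by the complement of `J`. -/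
noncomputable def merge (J : Set I) (a : ∀ j : J, Ω j) (b : ∀ j : (Jᶜ : Set I), Ω j) :
    ∀ i, Ω i :=
  fun i => if h : i ∈ J then a ⟨i, h⟩ else b ⟨i, h⟩

/-- `J` disintegrates the event `C`: `C` is the product of its projections to `J` and to the
complement of `J`. -/
def Disintegrates (J : Set I) (C : Set (∀ i, Ω i)) : Prop :=
  C = Set.image2 (merge J) (J.domRestrict '' C) (Jᶜ.domRestrict '' C)

/-- `J` generates `X` given `C`. -/
def Generates {α : Type*} (J : Set I) (X : (∀ i, Ω i) → α) (C : Set (∀ i, Ω i)) : Prop :=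
  IsDerivedOn (fun ω : (∀ i, Ω i) => J.domRestrict ω) X C ∧ Disintegrates J C

/-- The history of `X` given `C`: the intersection of all index sets that generate `X`
given `C`. -/
def history {α : Type*} (X : (∀ i, Ω i) → α) (C : Set (∀ i, Ω i)) : Set I :=
  ⋂₀ {J : Set I | Generates J X C}

/-- `X` and `Y` are structurally independent given `Z`. -/
def StructIndep {α β γ : Type*} (X : (∀ i, Ω i) → α) (Y : (∀ i, Ω i) → β)
    (Z : (∀ i, Ω i) → γ) : Prop :=
  ∀ z : γ, history X (Z ⁻¹' {z}) ∩ history Y (Z ⁻¹' {z}) = ∅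

end FactoredSpace

/-! ### Directed acyclic graphs and d-separation -/

/-- A directed acyclic graph on the vertex type `V`. -/
structure DAG (V : Type*) extends Digraph V where
  acyclic : ∀ v, ¬ Relation.TransGen Adj v v

namespace DAG

variable {V : Type*} (G : DAG V)

/-- The set of parents of `v`. -/
def parents (v : V) : Set V := {u | G.Adj u v}

/-- The undirected graph underlying `G`. -/
def skeleton : SimpleGraph V where
  Adj u v := G.Adj u v ∨ G.Adj v u
  symm := ⟨fun _ _ h => h.symm⟩
  loopless := ⟨fun v h => G.acyclic v (Relation.TransGen.single (h.elim id id))⟩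

variable {G}

/-- The `i`-th node of the walk `p` is a collider on it: an inner node at which both adjacent edges
of the walk point towards it. -/
def IsColliderAt {a b : V} (p : G.skeleton.Walk a b) (i : ℕ) : Prop :=
  0 < i ∧ i < p.length ∧
    G.Adj (p.getVert (i - 1)) (p.getVert i) ∧ G.Adj (p.getVert (i + 1)) (p.getVert i)

/-- The walk `p` is blocked by `Z`: some non-collider on it (end points included) lies in `Z`, or
some collider on it neither lies in `Z` nor has a descendant in `Z`. -/
def IsBlocked {a b : V} (p : G.skeleton.Walk a b) (Z : Set V) : Prop :=
  ∃ i ≤ p.length,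
    (¬ IsColliderAt p i ∧ p.getVert i ∈ Z) ∨
    (IsColliderAt p i ∧ ∀ d, Relation.ReflTransGen G.Adj (p.getVert i) d → d ∉ Z)

variable (G)

/-- `A` and `B` are d-separated given `Z`: every path (without repeated nodes, possibly with zero
edges) in the skeleton from a node of `A` to a node of `B` is blocked by `Z`. -/
def DSeparated (A B Z : Set V) : Prop :=
  ∀ a ∈ A, ∀ b ∈ B, ∀ p : G.skeleton.Walk a b, p.IsPath → IsBlocked p Z

/-! ### The factored space model constructed from a DAG

Each vertex `v` has a set `Val v` of possible values. -/

variable (Val : V → Type*)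

/-- The index set: pairs of a node `v` and an assignment of values to the parents of `v`. -/
abbrev Index : Type _ := Σ v : V, (∀ u : G.parents v, Val u)

/-- The factored space of `G`: the factor of the index `(v, x)` is `Val v`. -/
abbrev Space : Type _ := ∀ i : G.Index Val, Val i.1

theorem wellFounded_adj [Finite V] : WellFounded G.Adj := by
  have : Std.Irrefl (Relation.TransGen G.Adj) := ⟨G.acyclic⟩
  have : IsTrans V (Relation.TransGen G.Adj) := ⟨fun _ _ _ => Relation.TransGen.trans⟩
  exact Subrelation.wf (fun h => Relation.TransGen.single h)
    (Finite.wellFounded_of_trans_of_irrefl (Relation.TransGen G.Adj))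

variable {Val}

/-- The node variable `X_v`, by recursion along the edges: the coordinate of `ω` at the index made
of `v` and the values of the node variables of its parents. -/
noncomputable def nodeVar [Finite V] (v : V) (ω : G.Space Val) : Val v :=
  G.wellFounded_adj.fix (C := Val) (fun v X => ω ⟨v, fun u => X u.1 u.2⟩) v

/-- The defining equation of the node variables. -/
theorem nodeVar_eq [Finite V] (v : V) (ω : G.Space Val) :
    G.nodeVar v ω = ω ⟨v, fun u => G.nodeVar u.1 ω⟩ := by
  unfold nodeVar
  rw [WellFounded.fix_eq]

variable (Val)

/-- The joint variable `X_W` of the node variables of the nodes in `W`. -/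
noncomputable def jointVar [Finite V] (W : Set V) (ω : G.Space Val) : ∀ v : W, Val v :=
  fun v => G.nodeVar v.1 ω

end DAG

/-!
Call a node `v` relevant to `A` given `Z` if a noise variable attached to `v` by an extra edge into
`v` would be d-connected to `A` given `Z`. The relevant nodes form the closure of `A \ Z` under two
moves: to a parent outside `Z`, and from a node outside `Z` to a child that is in `Z` or has a
descendant in `Z` (`DAG.Relevant`). Both sides of the equivalence say that no node is relevant both
to `V₁` and to `V₂` given `V₃`.

*d-separation* (`DAG.dSeparated_iff`). Two derivations of relevance of the same node join to an
unblocked trail from `V₁` to `V₂`, and a shortest such trail is a path: at a node visited twice, the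
part between the visits can be cut out, because a trail that leaves a node along an outgoing edge
and returns to it contains a collider below that node. Conversely, along an unblocked path from `V₁`
to `V₂` the nodes are relevant to `V₁` until the path runs down to its end outside the ancestors
of `V₃`, and then the node at the top of this final descent is relevant to `V₂` too.

*Histories are small* (`DAG.generates_relevant`). The indices of the nodes relevant to `A` generate
`X_A` given `X_Z = z`: relevant nodes have all their parents outside `Z` relevant, and ancestors of
`Z` that are not relevant have none of them relevant, so in a point spliced from two points of
the event each of these nodes takes its value from one of the two.

*Histories are large* (`DAG.Relevant.refIndex_mem_history`). Fix reference values `x` of all nodes,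
and let `z` be their restriction to `Z`. Then the history contains the index `(v, x_pa(v))` of every
relevant node `v`. For this, points of the factored space are used in which a deviation from `x`
spreads to all descendants until it meets `Z` (`DAG.deviation`). A deviation at a node above `A`
changes `X_A`; and a deviation at a node `d` of `Z` is compatible with the event only together with
a deviation at a node above `d`, so no product decomposition of the event separates the two indices.
As the index depends on `x` and `v` only, a node relevant to both `V₁` and `V₂` gives a common element
of the two histories.
-/

/-! ### Splicing points of a factored space -/

namespace FactoredSpace

variable {I : Type*} {Ω : I → Type*}

open Classical in
/-- The point that agrees with `ω` on `J` and with `ω'` outside `J`. -/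
noncomputable def splice (J : Set I) (ω ω' : ∀ i, Ω i) : ∀ i, Ω i :=
  fun i => if i ∈ J then ω i else ω' i

theorem splice_of_mem {J : Set I} (ω ω' : ∀ i, Ω i) {i : I} (h : i ∈ J) :
    splice J ω ω' i = ω i := if_pos h

theorem splice_of_notMem {J : Set I} (ω ω' : ∀ i, Ω i) {i : I} (h : i ∉ J) :
    splice J ω ω' i = ω' i := if_neg h

theorem merge_domRestrict (J : Set I) (ω ω' : ∀ i, Ω i) :
    merge J (J.domRestrict ω) (Jᶜ.domRestrict ω') = splice J ω ω' := by
  funext i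
  by_cases h : i ∈ J <;> simp [merge, splice, h]

theorem disintegrates_iff {J : Set I} {C : Set (∀ i, Ω i)} :
    Disintegrates J C ↔ ∀ ω ∈ C, ∀ ω' ∈ C, splice J ω ω' ∈ C := by
  constructor
  · intro h ω hω ω' hω'
    unfold Disintegrates at h
    rw [h, ← merge_domRestrict]
    exact Set.mem_image2_of_mem ⟨ω, hω, rfl⟩ ⟨ω', hω', rfl⟩
  · intro h
    apply Set.Subset.antisymm
    · intro ω hω
      refine ⟨_, ⟨ω, hω, rfl⟩, _, ⟨ω, hω, rfl⟩, ?_⟩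
      rw [merge_domRestrict]
      funext i
      simp [splice]
    · rintro _ ⟨_, ⟨ω, hω, rfl⟩, _, ⟨ω', hω', rfl⟩, rfl⟩
      rw [merge_domRestrict]
      exact h ω hω ω' hω'

theorem isDerivedOn_iff {S α β : Type*} [Nonempty β] {X : S → α} {Y : S → β} {C : Set S} :
    IsDerivedOn X Y C ↔ ∀ ω ∈ C, ∀ ω' ∈ C, X ω = X ω' → Y ω = Y ω' := by
  classical
  constructor
  · rintro ⟨f, hf⟩ ω hω ω' hω' h
    rw [hf ω hω, hf ω' hω', h]
  · intro h
    refine ⟨fun a => if ha : ∃ ω ∈ C, X ω = a then Y ha.choose else Classical.arbitrary β, ?_⟩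
    intro ω hω
    have ha : ∃ ω' ∈ C, X ω' = X ω := ⟨ω, hω, rfl⟩
    simp only [dif_pos ha]
    exact h ω hω _ ha.choose_spec.1 ha.choose_spec.2.symm

end FactoredSpace

namespace DAG

variable {V : Type*} {G : DAG V}

/-! ### Nodes relevant to a set of nodes -/

variable (G) in
/-- The nodes that lie in `Z` or have a descendant in `Z`. -/
def ancestors (Z : Set V) : Set V := {v | ∃ d ∈ Z, Relation.ReflTransGen G.Adj v d}

theorem mem_ancestors_of_mem {Z : Set V} {v : V} (h : v ∈ Z) : v ∈ G.ancestors Z :=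
  ⟨v, h, .refl⟩

theorem mem_ancestors_of_adj {Z : Set V} {v w : V} (h : G.Adj v w) (hw : w ∈ G.ancestors Z) :
    v ∈ G.ancestors Z :=
  let ⟨d, hd, hwd⟩ := hw
  ⟨d, hd, .head h hwd⟩

variable (G) in
/-- `G.Relevant A Z v` says that a noise variable attached to `v` by an extra edge into `v` would be
d-connected to `A` given `Z`. It is encoded as the closure of `A \ Z` under passing to a parent
outside `Z`, and from a node outside `Z` to a child in `G.ancestors Z`. -/
inductive Relevant (A Z : Set V) : V → Prop
  | base {v : V} : v ∈ A → v ∉ Z → Relevant A Z v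
  | up {u v : V} : Relevant A Z v → G.Adj u v → u ∉ Z → Relevant A Z u
  | down {v w : V} : Relevant A Z v → v ∉ Z → G.Adj v w → w ∈ G.ancestors Z → Relevant A Z w

variable (G) in
/-- The edges that leave a node outside `Z`. -/
def EdgeOff (Z : Set V) (u v : V) : Prop := u ∉ Z ∧ G.Adj u v

theorem Relevant.of_edgeOff {A Z : Set V} {u v : V} (h : Relation.ReflTransGen (G.EdgeOff Z) u v)
    (hv : G.Relevant A Z v) : G.Relevant A Z u := by
  induction h using Relation.ReflTransGen.head_induction_on with
  | refl => exact hv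
  | head h _ ih => exact ih.up h.2 h.1

/-- A directed path to `Z`, cut at its first node in `Z`. -/
theorem exists_edgeOff_of_mem_ancestors {Z : Set V} {v : V} (h : v ∈ G.ancestors Z) :
    ∃ d ∈ Z, Relation.ReflTransGen (G.EdgeOff Z) v d := by
  obtain ⟨d, hd, h⟩ := h
  induction h using Relation.ReflTransGen.head_induction_on with
  | refl => exact ⟨d, hd, .refl⟩
  | @head u w huw _ ih =>
    by_cases hu : u ∈ Z
    · exact ⟨u, hu, .refl⟩
    · obtain ⟨e, he, hwe⟩ := ih
      exact ⟨e, he, .head ⟨hu, huw⟩ hwe⟩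

theorem not_adj_of_adj {u v : V} (h : G.Adj u v) : ¬ G.Adj v u :=
  fun h' => G.acyclic u (.head h (.single h'))

/-! ### Active trails -/

variable (G) in
/-- `b` does not block a trail that runs through it between the neighbours `a` and `c`. -/
def Passes (Z : Set V) (a b c : V) : Prop :=
  (G.Adj a b ∧ G.Adj c b → b ∈ G.ancestors Z) ∧ (¬ (G.Adj a b ∧ G.Adj c b) → b ∉ Z)

theorem Passes.symm {Z : Set V} {a b c : V} (h : G.Passes Z a b c) : G.Passes Z c b a :=
  ⟨fun h' => h.1 h'.symm, fun h' => h.2 fun h'' => h' h''.symm⟩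

variable (G) in
/-- `f 0, …, f n` is a trail, possibly with repeated nodes, in the skeleton of `G` that is not
blocked by `Z` at any of its inner nodes. Its end points are unrestricted, and the values of `f`
beyond `n` are irrelevant. -/
structure Trail (Z : Set V) (f : ℕ → V) (n : ℕ) : Prop where
  adj : ∀ i, i < n → G.skeleton.Adj (f i) (f (i + 1))
  passes : ∀ i, i + 2 ≤ n → G.Passes Z (f i) (f (i + 1)) (f (i + 2))

variable (G) in
/-- The trail `f 0, …, f n` would not be blocked at `f n` if it were continued along an edge
into `f n`. -/
def EndsOpen (Z : Set V) (f : ℕ → V) (n : ℕ) : Prop :=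
  ((0 < n ∧ G.Adj (f (n - 1)) (f n)) → f n ∈ G.ancestors Z) ∧
    (¬ (0 < n ∧ G.Adj (f (n - 1)) (f n)) → f n ∉ Z)

/-- Two trails with a common end, each open there, can be joined. -/
theorem Trail.join {Z : Set V} {f g : ℕ → V} {n m : ℕ} (hf : G.Trail Z f n) (hg : G.Trail Z g m)
    (hfo : G.EndsOpen Z f n) (hgo : G.EndsOpen Z g m) (h : f n = g m) :
    G.Trail Z (fun k => if k ≤ n then f k else g (n + m - k)) (n + m) := by
  constructor
  · intro i hi
    rcases lt_trichotomy i n with hin | rfl | hin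
    · simp only [if_pos hin.le, if_pos (show i + 1 ≤ n by omega)]
      exact hf.adj i hin
    · simp only [le_refl, if_true, if_neg (show ¬ i + 1 ≤ i by omega)]
      have := hg.adj (m - 1) (by omega)
      rw [show m - 1 + 1 = m by omega, ← h] at this
      rw [show i + m - (i + 1) = m - 1 by omega]
      exact this.symm
    · simp only [if_neg (show ¬ i ≤ n by omega), if_neg (show ¬ i + 1 ≤ n by omega)]
      have := hg.adj (n + m - (i + 1)) (by omega)
      rw [show n + m - (i + 1) + 1 = n + m - i by omega] at this
      exact this.symm
  · intro i hi
    rcases lt_trichotomy (i + 1) n with hin | hin | hin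
    · simp only [if_pos (show i ≤ n by omega), if_pos (show i + 1 ≤ n by omega),
        if_pos (show i + 2 ≤ n by omega)]
      exact hf.passes i hin
    · subst hin
      simp only [if_pos (show i ≤ i + 1 by omega), le_refl, if_true,
        if_neg (show ¬ i + 2 ≤ i + 1 by omega)]
      rw [show i + 1 + m - (i + 2) = m - 1 by omega]
      have h0 : 0 < i + 1 := by omega
      have hm : 0 < m := by omega
      simp only [EndsOpen, h0, hm, true_and, ← h, Nat.add_sub_cancel] at hfo hgo
      refine ⟨fun h' => hfo.1 h'.1, fun h' => ?_⟩
      by_cases h1 : G.Adj (f i) (f (i + 1))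
      · exact hgo.2 fun h2 => h' ⟨h1, h2⟩
      · exact hfo.2 h1
    · have h1 : (if i ≤ n then f i else g (n + m - i)) = g (n + m - i) := by
        split_ifs with hi'
        · obtain rfl : i = n := by omega
          rw [h]; congr 1; omega
        · rfl
      simp only [h1, if_neg (show ¬ i + 1 ≤ n by omega), if_neg (show ¬ i + 2 ≤ n by omega)]
      have := hg.passes (n + m - (i + 2)) (by omega)
      rw [show n + m - (i + 2) + 1 = n + m - (i + 1) by omega,
        show n + m - (i + 2) + 2 = n + m - i by omega] at this
      exact this.symm

theorem Trail.extend {Z : Set V} {f : ℕ → V} {n : ℕ} (hf : G.Trail Z f n) {w : V}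
    (hw : G.skeleton.Adj (f n) w) (hp : 0 < n → G.Passes Z (f (n - 1)) (f n) w) :
    G.Trail Z (fun k => if k ≤ n then f k else w) (n + 1) := by
  constructor
  · intro i hi
    rcases (show i < n ∨ i = n by omega) with hin | rfl
    · simp only [if_pos hin.le, if_pos (show i + 1 ≤ n by omega)]
      exact hf.adj i hin
    · simpa using hw
  · intro i hi
    rcases (show i + 2 ≤ n ∨ i + 1 = n by omega) with hin | rfl
    · simp only [if_pos (show i ≤ n by omega), if_pos (show i + 1 ≤ n by omega), if_pos hin]
      exact hf.passes i hin
    · simpa using hp (by omega)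

theorem Relevant.exists_trail {A Z : Set V} {v : V} (h : G.Relevant A Z v) :
    ∃ f n, G.Trail Z f n ∧ f 0 ∈ A ∧ f 0 ∉ Z ∧ f n = v ∧ G.EndsOpen Z f n := by
  induction h with
  | @base v hA hZ =>
    exact ⟨fun _ => v, 0, ⟨fun _ h => by omega, fun _ h => by omega⟩, hA, hZ, rfl,
      ⟨fun h => absurd h.1 (lt_irrefl 0), fun _ => hZ⟩⟩
  | @up u v _ huv hu ih =>
    obtain ⟨f, n, hf, h0, h0', rfl, ho⟩ := ih
    refine ⟨_, n + 1, hf.extend (w := u) (Or.inr huv) ?_, by simpa, by simpa, by simp, ?_⟩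
    · intro hn
      simp only [EndsOpen, hn, true_and] at ho
      exact ⟨fun h => ho.1 h.1, fun h => ho.2 fun h' => h ⟨h', huv⟩⟩
    · refine ⟨fun h => ?_, fun _ => by simpa⟩
      exact absurd (by simpa using h.2) (not_adj_of_adj huv)
  | @down v w _ hv hvw hw ih =>
    obtain ⟨f, n, hf, h0, h0', rfl, ho⟩ := ih
    refine ⟨_, n + 1, hf.extend (w := w) (Or.inl hvw) ?_, by simpa, by simpa, by simp, ?_⟩
    · exact fun _ => ⟨fun h => absurd h.2 (not_adj_of_adj hvw), fun _ => hv⟩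
    · refine ⟨fun _ => by simpa, fun h => absurd ?_ h⟩
      simpa using hvw

/-- A trail that leaves `f i` along an edge out of `f i` and later returns to `f i` must contain a
collider that descends from `f i`, as `G` has no directed cycles. -/
theorem Trail.mem_ancestors_of_return {Z : Set V} {f : ℕ → V} {n : ℕ} (hf : G.Trail Z f n)
    {i j : ℕ} (hij : i < j) (hj : j ≤ n) (h : f i = f j) (hi : G.Adj (f i) (f (i + 1))) :
    f i ∈ G.ancestors Z := by
  by_contra hZ
  have key : ∀ k, i + 1 + k ≤ j →
      Relation.TransGen G.Adj (f i) (f (i + 1 + k)) ∧ G.Adj (f (i + k)) (f (i + 1 + k)) := by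
    intro k
    induction k with
    | zero => exact fun _ => ⟨.single hi, hi⟩
    | succ k ih =>
      intro hk
      obtain ⟨h1, h2⟩ := ih (by omega)
      have hp := hf.passes (i + k) (by omega)
      rw [show i + k + 1 = i + 1 + k by omega, show i + k + 2 = i + 1 + (k + 1) by omega] at hp
      have ha := hf.adj (i + 1 + k) (by omega)
      rw [show i + 1 + k + 1 = i + 1 + (k + 1) by omega] at ha
      rw [show i + (k + 1) = i + 1 + k by omega]
      rcases ha with ha | ha
      · exact ⟨h1.tail ha, ha⟩
      · obtain ⟨d, hd, hd'⟩ := hp.1 ⟨h2, ha⟩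
        exact absurd ⟨d, hd, h1.to_reflTransGen.trans hd'⟩ hZ
  have := (key (j - (i + 1)) (by omega)).1
  rw [show i + 1 + (j - (i + 1)) = j by omega, ← h] at this
  exact G.acyclic _ this

/-- Cutting out the part of a trail between two visits to the same node leaves a trail. -/
theorem Trail.shortcut {Z : Set V} {f : ℕ → V} {n : ℕ} (hf : G.Trail Z f n) {i j : ℕ}
    (hij : i < j) (hj : j ≤ n) (h : f i = f j) :
    G.Trail Z (fun k => if k ≤ i then f k else f (k + (j - i))) (n - (j - i)) := by
  constructor
  · intro k hk
    rcases lt_trichotomy k i with hki | rfl | hki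
    · simp only [if_pos hki.le, if_pos (show k + 1 ≤ i by omega)]
      exact hf.adj k (by omega)
    · simp only [le_refl, if_true, if_neg (show ¬ k + 1 ≤ k by omega)]
      rw [h, show k + 1 + (j - k) = j + 1 by omega]
      exact hf.adj j (by omega)
    · simp only [if_neg (show ¬ k ≤ i by omega), if_neg (show ¬ k + 1 ≤ i by omega)]
      rw [show k + 1 + (j - i) = k + (j - i) + 1 by omega]
      exact hf.adj _ (by omega)
  · intro k hk
    rcases lt_trichotomy (k + 1) i with hki | rfl | hki
    · simp only [if_pos (show k ≤ i by omega), if_pos (show k + 1 ≤ i by omega),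
        if_pos (show k + 2 ≤ i by omega)]
      exact hf.passes k (by omega)
    · simp only [if_pos (show k ≤ k + 1 by omega), le_refl, if_true,
        if_neg (show ¬ k + 2 ≤ k + 1 by omega)]
      rw [show k + 2 + (j - (k + 1)) = j + 1 by omega]
      have p1 := hf.passes k (by omega)
      have p2 := hf.passes (j - 1) (by omega)
      rw [show j - 1 + 1 = j by omega, show j - 1 + 2 = j + 1 by omega, ← h] at p2
      refine ⟨fun hc => ?_, fun hc => ?_⟩
      · rcases hf.adj (k + 1) (by omega) with ha | ha
        · exact hf.mem_ancestors_of_return hij hj h ha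
        · exact p1.1 ⟨hc.1, ha⟩
      · by_cases h1 : G.Adj (f k) (f (k + 1))
        · exact p2.2 fun h2 => hc ⟨h1, h2.2⟩
        · exact p1.2 fun h2 => h1 h2.1
    · have h1 : (if k ≤ i then f k else f (k + (j - i))) = f (k + (j - i)) := by
        split_ifs with hk'
        · obtain rfl : k = i := by omega
          rw [h]; congr 1; omega
        · rfl
      simp only [h1, if_neg (show ¬ k + 1 ≤ i by omega), if_neg (show ¬ k + 2 ≤ i by omega)]
      rw [show k + 1 + (j - i) = k + (j - i) + 1 by omega,
        show k + 2 + (j - i) = k + (j - i) + 2 by omega]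
      exact hf.passes _ (by omega)

/-- A shortest trail between two sets of nodes visits no node twice. -/
theorem Trail.exists_injOn {A B Z : Set V} {f : ℕ → V} {n : ℕ} (hf : G.Trail Z f n)
    (hA : f 0 ∈ A) (hB : f n ∈ B) :
    ∃ f n, G.Trail Z f n ∧ f 0 ∈ A ∧ f n ∈ B ∧ Set.InjOn f {i | i ≤ n} := by
  induction n using Nat.strong_induction_on generalizing f with
  | _ n ih =>
    by_cases hinj : Set.InjOn f {i | i ≤ n}
    · exact ⟨f, n, hf, hA, hB, hinj⟩
    · have : ∃ i j, i < j ∧ j ≤ n ∧ f i = f j := by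
        simp only [Set.InjOn, Set.mem_ofPred_eq] at hinj
        push Not at hinj
        obtain ⟨i, hi, j, hj, h, hne⟩ := hinj
        rcases lt_or_gt_of_ne hne with hlt | hlt
        · exact ⟨i, j, hlt, hj, h⟩
        · exact ⟨j, i, hlt, hi, h.symm⟩
      obtain ⟨i, j, hij, hj, h⟩ := this
      refine ih (n - (j - i)) (by omega) (hf.shortcut hij hj h) (by simpa using hA) ?_
      split_ifs with hc
      · obtain rfl : j = n := by omega
        rwa [show j - (j - i) = i by omega, h]
      · rwa [show n - (j - i) + (j - i) = n by omega]

theorem exists_walk_getVert_eq {H : SimpleGraph V} (f : ℕ → V) (n : ℕ)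
    (h : ∀ i, i < n → H.Adj (f i) (f (i + 1))) :
    ∃ p : H.Walk (f 0) (f n), p.length = n ∧ ∀ i ≤ n, p.getVert i = f i := by
  induction n generalizing f with
  | zero =>
    refine ⟨.nil, rfl, fun i hi => ?_⟩
    obtain rfl : i = 0 := by omega
    rfl
  | succ n ih =>
    obtain ⟨p, hp, hv⟩ := ih (fun i => f (i + 1)) fun i hi => h (i + 1) (by omega)
    refine ⟨.cons (h 0 (by omega)) p, by simp [hp], fun i hi => ?_⟩
    cases i with
    | zero => simp
    | succ i => simpa using hv i (by omega)

/-! ### d-separation in terms of relevance -/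

theorem exists_relevant_of_not_isBlocked {A B Z : Set V} {a b : V} (p : G.skeleton.Walk a b)
    (ha : a ∈ A) (hb : b ∈ B) (hp : ¬ IsBlocked p Z) :
    ∃ v, G.Relevant A Z v ∧ G.Relevant B Z v := by
  simp only [IsBlocked, not_exists, not_and, not_or, Classical.not_not, not_forall] at hp
  have hnc : ∀ i ≤ p.length, ¬ IsColliderAt p i → p.getVert i ∉ Z := fun i hi => (hp i hi).1
  have hc : ∀ i ≤ p.length, IsColliderAt p i → p.getVert i ∈ G.ancestors Z := fun i hi h =>
    let ⟨d, hd, hdZ⟩ := (hp i hi).2 h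
    ⟨d, hdZ, hd⟩
  have ha' : a ∉ Z := by simpa using hnc 0 (by omega) fun h => by simpa using h.1
  have hb' : b ∉ Z := by simpa using hnc p.length le_rfl fun h => by simpa using h.2.1
  have key : ∀ i ≤ p.length, G.Relevant A Z (p.getVert i) ∨
      (∃ w, G.Relevant A Z w ∧ Relation.ReflTransGen (G.EdgeOff Z) w (p.getVert i)) ∧
        p.getVert i ∉ G.ancestors Z ∧ 0 < i ∧ G.Adj (p.getVert (i - 1)) (p.getVert i) := by
    intro i
    induction i with
    | zero => exact fun _ => Or.inl (by simpa using Relevant.base ha ha')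
    | succ i ih =>
      intro hi
      have hadj : G.skeleton.Adj (p.getVert i) (p.getVert (i + 1)) :=
        p.adj_getVert_succ (by omega)
      rcases ih (by omega) with h | ⟨⟨w, hw, hwi⟩, hanc, hi0, hin⟩
      · rcases hadj with hadj | hadj
        · have hiZ : p.getVert i ∉ Z := hnc i (by omega) fun h => not_adj_of_adj hadj h.2.2.2
          by_cases hanc : p.getVert (i + 1) ∈ G.ancestors Z
          · exact Or.inl (h.down hiZ hadj hanc)
          · exact Or.inr ⟨⟨_, h, .single ⟨hiZ, hadj⟩⟩, hanc, by omega, by simpa using hadj⟩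
        · refine Or.inl (h.up hadj (hnc (i + 1) hi fun h => ?_))
          exact not_adj_of_adj hadj (by simpa using h.2.2.1)
      · -- outside `G.ancestors Z` there is no collider, so the walk goes on in the same direction
        have hiZ : p.getVert i ∉ Z := fun h => hanc (mem_ancestors_of_mem h)
        rcases hadj with hadj | hadj
        · exact Or.inr ⟨⟨w, hw, hwi.tail ⟨hiZ, hadj⟩⟩,
            fun h => hanc (mem_ancestors_of_adj hadj h), by omega, by simpa using hadj⟩
        · exact absurd (hc i (by omega) ⟨hi0, by omega, hin, hadj⟩) hanc
  have hB : G.Relevant B Z b := .base hb hb'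
  rcases key p.length le_rfl with h | ⟨⟨w, hw, hwb⟩, -⟩
  · exact ⟨b, by simpa using h, hB⟩
  · exact ⟨w, hw, .of_edgeOff (by simpa using hwb) hB⟩

theorem exists_isPath_of_relevant {A B Z : Set V} {v : V} (hA : G.Relevant A Z v)
    (hB : G.Relevant B Z v) :
    ∃ a ∈ A, ∃ b ∈ B, ∃ p : G.skeleton.Walk a b, p.IsPath ∧ ¬ IsBlocked p Z := by
  obtain ⟨f, n, hf, hf0, hf0', hfn, hfo⟩ := hA.exists_trail
  obtain ⟨g, m, hg, hg0, hg0', hgm, hgo⟩ := hB.exists_trail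
  have hend : (if n + m ≤ n then f (n + m) else g (n + m - (n + m))) = g 0 := by
    split_ifs with h
    · obtain rfl : m = 0 := by omega
      simp [hfn, hgm]
    · simp
  -- shortening keeps the end points outside `Z` because it is done between `A \ Z` and `B \ Z`
  obtain ⟨f, n, hf, h0, hn, hinj⟩ :=
    (hf.join hg hfo hgo (hfn.trans hgm.symm)).exists_injOn (A := A \ Z) (B := B \ Z)
      (by simpa using ⟨hf0, hf0'⟩) (by simp only [hend]; exact ⟨hg0, hg0'⟩)
  obtain ⟨p, hlen, hp⟩ := exists_walk_getVert_eq f n hf.adj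
  refine ⟨_, h0.1, _, hn.1, p, ?_, ?_⟩
  · rw [← SimpleGraph.Walk.IsPath.getVert_injOn_iff, hlen]
    intro i hi j hj hij
    rw [hp i hi, hp j hj] at hij
    exact hinj hi hj hij
  · rintro ⟨i, hi, h⟩
    rw [hlen] at hi
    rw [hp i hi] at h
    rcases Nat.eq_zero_or_pos i with rfl | hi0
    · exact h.elim (fun h => h0.2 h.2) fun h => lt_irrefl 0 h.1.1
    rcases hi.eq_or_lt with rfl | hin
    · exact h.elim (fun h => hn.2 h.2) fun h => absurd h.1.2.1 (by omega)
    obtain ⟨i, rfl⟩ : ∃ k, i = k + 1 := ⟨i - 1, by omega⟩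
    have hpass := hf.passes i hin
    have hcol : IsColliderAt p (i + 1) ↔
        G.Adj (f i) (f (i + 1)) ∧ G.Adj (f (i + 2)) (f (i + 1)) := by
      simp only [IsColliderAt, hlen, hi0, hin, true_and, Nat.add_sub_cancel]
      rw [hp i (by omega), hp (i + 1) hi, hp (i + 1 + 1) hin]
    rw [hcol] at h
    rcases h with ⟨h1, h2⟩ | ⟨h1, h2⟩
    · exact hpass.2 h1 h2
    · obtain ⟨d, hd, hd'⟩ := hpass.1 h1
      exact h2 d hd' hd

theorem dSeparated_iff {A B Z : Set V} :
    G.DSeparated A B Z ↔ ∀ v, G.Relevant A Z v → ¬ G.Relevant B Z v := by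
  constructor
  · intro h v hA hB
    obtain ⟨a, ha, b, hb, p, hp, hp'⟩ := exists_isPath_of_relevant hA hB
    exact hp' (h a ha b hb p hp)
  · intro h a ha b hb p _
    by_contra hp
    obtain ⟨v, hA, hB⟩ := exists_relevant_of_not_isBlocked p ha hb hp
    exact h v hA hB

/-! ### Histories contain only indices of relevant nodes -/

section Histories

open FactoredSpace

variable [Finite V] {Val : V → Type*}

theorem jointVar_eq_iff {W : Set V} {ω ω' : G.Space Val} :
    G.jointVar Val W ω = G.jointVar Val W ω' ↔ ∀ v ∈ W, G.nodeVar v ω = G.nodeVar v ω' := by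
  simp [jointVar, funext_iff]

/-- After a point of `{X_Z = z}` is replaced by another one at the indices of the nodes that are not
relevant, all relevant nodes keep their values, and all other ancestors of `Z` take the values
they have at the other point. -/
theorem nodeVar_splice {A Z : Set V} {ω ω' : G.Space Val}
    (h : ∀ v ∈ Z, G.nodeVar v ω = G.nodeVar v ω') (v : V) :
    (G.Relevant A Z v →
      G.nodeVar v (splice {i : G.Index Val | G.Relevant A Z i.1} ω ω') = G.nodeVar v ω) ∧
    (v ∈ G.ancestors Z → ¬ G.Relevant A Z v →
      G.nodeVar v (splice {i : G.Index Val | G.Relevant A Z i.1} ω ω') = G.nodeVar v ω') := by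
  induction v using G.wellFounded_adj.induction with
  | _ v ih =>
    have hZ : ∀ u ∈ Z, G.Adj u v →
        G.nodeVar u (splice {i : G.Index Val | G.Relevant A Z i.1} ω ω') = G.nodeVar u ω := by
      intro u hu huv
      by_cases hr : G.Relevant A Z u
      · exact (ih u huv).1 hr
      · rw [(ih u huv).2 (mem_ancestors_of_mem hu) hr, h u hu]
    constructor
    · intro hv
      rw [nodeVar_eq, nodeVar_eq G v ω, splice_of_mem _ _ (by exact hv)]
      congr 2
      funext ⟨u, hu⟩
      by_cases huZ : u ∈ Z
      · exact hZ u huZ hu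
      · exact (ih u hu).1 (hv.up hu huZ)
    · intro hanc hv
      rw [nodeVar_eq, nodeVar_eq G v ω', splice_of_notMem _ _ (by exact hv)]
      congr 2
      funext ⟨u, hu⟩
      by_cases huZ : u ∈ Z
      · exact (hZ u huZ hu).trans (h u huZ)
      · exact (ih u hu).2 (mem_ancestors_of_adj hu hanc) fun hr => hv (hr.down huZ hu hanc)

theorem generates_relevant [∀ v, Nonempty (Val v)] (A Z : Set V) (z : ∀ v : Z, Val v) :
    Generates {i : G.Index Val | G.Relevant A Z i.1} (G.jointVar Val A)
      (G.jointVar Val Z ⁻¹' {z}) := by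
  have hC : ∀ ω ∈ G.jointVar Val Z ⁻¹' {z}, ∀ ω' ∈ G.jointVar Val Z ⁻¹' {z},
      ∀ v ∈ Z, G.nodeVar v ω = G.nodeVar v ω' := fun ω hω ω' hω' =>
    jointVar_eq_iff.1 (Eq.trans hω (Eq.symm hω'))
  constructor
  · rw [isDerivedOn_iff]
    intro ω hω ω' hω' h
    have hs : splice {i : G.Index Val | G.Relevant A Z i.1} ω ω' = ω' := by
      funext i
      by_cases hi : G.Relevant A Z i.1
      · rw [splice_of_mem _ _ (by exact hi)]
        exact congrFun h ⟨i, hi⟩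
      · exact splice_of_notMem _ _ hi
    rw [jointVar_eq_iff]
    intro v hv
    by_cases hvZ : v ∈ Z
    · exact hC ω hω ω' hω' v hvZ
    · have := (nodeVar_splice (A := A) (hC ω hω ω' hω') v).1 (.base hv hvZ)
      rw [hs] at this
      exact this.symm
  · rw [disintegrates_iff]
    intro ω hω ω' hω'
    refine Eq.trans ?_ hω
    rw [jointVar_eq_iff]
    intro v hv
    by_cases hr : G.Relevant A Z v
    · exact (nodeVar_splice (hC ω hω ω' hω') v).1 hr
    · rw [(nodeVar_splice (hC ω hω ω' hω') v).2 (mem_ancestors_of_mem hv) hr]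
      exact (hC ω hω ω' hω' v hv).symm

end Histories

/-! ### Histories contain an index of every relevant node -/

section Deviation

open FactoredSpace

variable {Val : V → Type*}

variable (G) in
/-- The index of `v` at which the parents of `v` take the reference values `x`. -/
def refIndex (x : ∀ v, Val v) (v : V) : G.Index Val := ⟨v, fun u => x u⟩

open Classical in
variable (G) in
/-- A point of the factored space that sends deviations from the reference values `x` along the
edges of `G` until they reach `Z`: a node all of whose parents have their reference values takes
its reference value, or the alternative value `y` if it lies in `T`; a node with a deviating parent
takes its reference value if it lies in `Z`, and its alternative value otherwise. -/
noncomputable def deviation (x y : ∀ v, Val v) (Z T : Set V) : G.Space Val :=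
  fun i => if i = G.refIndex x i.1 then (if i.1 ∈ T then y i.1 else x i.1)
    else (if i.1 ∈ Z then x i.1 else y i.1)

variable {x y : ∀ v, Val v} {Z T : Set V}

theorem deviation_congr {T' : Set V} {i : G.Index Val}
    (h : i = G.refIndex x i.1 → (i.1 ∈ T ↔ i.1 ∈ T')) :
    G.deviation x y Z T i = G.deviation x y Z T' i := by
  classical
  unfold deviation
  by_cases hi : i = G.refIndex x i.1
  · rw [if_pos hi, if_pos hi]
    exact if_congr (h hi) rfl rfl
  · rw [if_neg hi, if_neg hi]

variable [Finite V]

open Classical in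
theorem nodeVar_deviation_of_forall_eq {v : V}
    (h : ∀ u, G.Adj u v → G.nodeVar u (G.deviation x y Z T) = x u) :
    G.nodeVar v (G.deviation x y Z T) = if v ∈ T then y v else x v := by
  have h' : (fun u : G.parents v => G.nodeVar u.1 (G.deviation x y Z T)) =
      fun u : G.parents v => x u.1 := by
    funext ⟨u, hu⟩
    exact h u hu
  rw [nodeVar_eq, h']
  exact if_pos rfl

open Classical in
theorem nodeVar_deviation_of_exists_ne {v : V}
    (h : ∃ u, G.Adj u v ∧ G.nodeVar u (G.deviation x y Z T) ≠ x u) :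
    G.nodeVar v (G.deviation x y Z T) = if v ∈ Z then x v else y v := by
  obtain ⟨u, hu, hne⟩ := h
  have h' : (⟨v, fun u => G.nodeVar u.1 (G.deviation x y Z T)⟩ : G.Index Val) ≠
      G.refIndex x v := by
    intro he
    unfold refIndex at he
    rw [Sigma.mk.injEq, heq_eq_eq] at he
    exact hne (congrFun he.2 ⟨u, hu⟩)
  rw [nodeVar_eq]
  exact if_neg h'

theorem nodeVar_deviation_of_notMem {v : V} (hvZ : v ∈ Z) (hvT : v ∉ T) :
    G.nodeVar v (G.deviation x y Z T) = x v := by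
  classical
  by_cases h : ∀ u, G.Adj u v → G.nodeVar u (G.deviation x y Z T) = x u
  · rw [nodeVar_deviation_of_forall_eq h, if_neg hvT]
  · push Not at h
    rw [nodeVar_deviation_of_exists_ne h, if_pos hvZ]

open Classical in
/-- No deviation reaches a node that has no proper ancestor in `T`. -/
theorem nodeVar_deviation_of_forall_transGen {v : V}
    (h : ∀ u, Relation.TransGen G.Adj u v → u ∉ T) :
    G.nodeVar v (G.deviation x y Z T) = if v ∈ T then y v else x v := by
  classical
  have : ∀ w, Relation.TransGen G.Adj w v → G.nodeVar w (G.deviation x y Z T) = x w := by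
    intro w
    induction w using G.wellFounded_adj.induction with
    | _ w ih =>
      intro hw
      rw [nodeVar_deviation_of_forall_eq fun u hu => ih u hu (.head hu hw), if_neg (h w hw)]
  exact nodeVar_deviation_of_forall_eq fun u hu => this u (.single hu)

theorem nodeVar_deviation_empty (v : V) : G.nodeVar v (G.deviation x y Z ∅) = x v := by
  classical
  rw [nodeVar_deviation_of_forall_transGen (by simp), if_neg (by simp)]

/-- Deviations spread along directed paths outside `Z`. -/
theorem nodeVar_deviation_ne (hxy : ∀ v, y v ≠ x v) {u v : V}
    (h : Relation.ReflTransGen (G.EdgeOff Z) u v) (hv : v ∉ Z)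
    (hu : G.nodeVar u (G.deviation x y Z T) ≠ x u) :
    G.nodeVar v (G.deviation x y Z T) ≠ x v := by
  classical
  induction h with
  | refl => exact hu
  | tail _ hbc ih =>
    rw [nodeVar_deviation_of_exists_ne ⟨_, hbc.2, ih hbc.1⟩, if_neg hv]
    exact hxy _

theorem mem_event_iff {ω : G.Space Val} :
    ω ∈ G.jointVar Val Z ⁻¹' {Z.domRestrict x} ↔ ∀ v ∈ Z, G.nodeVar v ω = x v := by
  simp [jointVar, funext_iff]

/-- A node of `A` reacts to a change at the reference index of any node from which a directed path
outside `Z` leads to it. -/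
theorem refIndex_mem_of_generates [∀ v, Nontrivial (Val v)] {A : Set V} {J : Set (G.Index Val)}
    (hJ : Generates J (G.jointVar Val A) (G.jointVar Val Z ⁻¹' {Z.domRestrict x})) {u a : V}
    (h : Relation.ReflTransGen (G.EdgeOff Z) u a) (ha : a ∈ A) (haZ : a ∉ Z) :
    G.refIndex x u ∈ J := by
  classical
  choose y hxy using fun v => exists_ne (x v)
  have huZ : u ∉ Z := by
    rcases h.cases_head with rfl | ⟨w, hw, _⟩
    exacts [haZ, hw.1]
  by_contra hu
  obtain ⟨F, hF⟩ := hJ.1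
  have h1 := hF (G.deviation x y Z ∅)
    (mem_event_iff.2 fun v _ => nodeVar_deviation_empty v)
  have h2 := hF (G.deviation x y Z {u})
    (mem_event_iff.2 fun v hv => nodeVar_deviation_of_notMem hv fun h => huZ (h ▸ hv))
  have h3 : J.domRestrict (G.deviation x y Z ∅) = J.domRestrict (G.deviation x y Z {u}) := by
    funext ⟨i, hi⟩
    refine deviation_congr fun he => ?_
    have : i.1 ≠ u := fun h => hu (by
      change i = _ at he
      rwa [he, h] at hi)
    simpa using this
  simp only [h3, ← h2] at h1
  have h4 := jointVar_eq_iff.1 h1 a ha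
  rw [nodeVar_deviation_empty] at h4
  refine nodeVar_deviation_ne hxy h haZ ?_ h4.symm
  rw [nodeVar_deviation_of_forall_transGen, if_pos (Set.mem_singleton u)]
  · exact hxy u
  · rintro w hw rfl
    exact G.acyclic _ hw

/-- If a directed path outside `Z` leads from `u` to `d ∈ Z`, no decomposition of `{X_Z = z}` as a
product separates the reference indices of `u` and `d`: the deviation at `d` is compatible with the
event together with the deviation at `u`, which reroutes `d` to another index, but not alone. -/
theorem refIndex_mem_iff_of_disintegrates [∀ v, Nontrivial (Val v)] {J : Set (G.Index Val)}
    (hJ : Disintegrates J (G.jointVar Val Z ⁻¹' {Z.domRestrict x})) {u d : V}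
    (h : Relation.ReflTransGen (G.EdgeOff Z) u d) (hd : d ∈ Z) :
    G.refIndex x u ∈ J ↔ G.refIndex x d ∈ J := by
  classical
  choose y hxy using fun v => exists_ne (x v)
  rw [disintegrates_iff] at hJ
  rcases h.cases_tail with rfl | ⟨w, huw, hwZ, hwd⟩
  · rfl
  have hud : Relation.TransGen G.Adj u d :=
    .tail' (Relation.ReflTransGen.mono (fun _ _ h => h.2) _ _ huw) hwd
  have huZ : u ∉ Z := by
    rcases huw.cases_head with rfl | ⟨w, hw, _⟩
    exacts [hwZ, hw.1]
  have h0 : G.deviation x y Z ∅ ∈ G.jointVar Val Z ⁻¹' {Z.domRestrict x} :=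
    mem_event_iff.2 fun v _ => nodeVar_deviation_empty v
  have h2 : G.deviation x y Z {u, d} ∈ G.jointVar Val Z ⁻¹' {Z.domRestrict x} := by
    rw [mem_event_iff]
    intro v hv
    by_cases hvd : v = d
    · subst hvd
      rw [nodeVar_deviation_of_exists_ne, if_pos hv]
      refine ⟨w, hwd, nodeVar_deviation_ne hxy huw hwZ ?_⟩
      rw [nodeVar_deviation_of_forall_transGen, if_pos (by simp)]
      · exact hxy u
      · rintro t ht (rfl | rfl)
        exacts [G.acyclic _ ht, G.acyclic _ (hud.trans ht)]
    · refine nodeVar_deviation_of_notMem hv ?_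
      rintro (rfl | rfl)
      exacts [huZ hv, hvd rfl]
  have h1 : G.deviation x y Z {d} ∉ G.jointVar Val Z ⁻¹' {Z.domRestrict x} := by
    rw [mem_event_iff]
    intro h
    have := h d hd
    rw [nodeVar_deviation_of_forall_transGen, if_pos (Set.mem_singleton d)] at this
    · exact hxy d this
    · rintro t ht rfl
      exact G.acyclic _ ht
  constructor
  · intro hu
    by_contra hdJ
    refine h1 ?_
    convert hJ _ h0 _ h2
    funext i
    by_cases hi : i ∈ J
    · rw [splice_of_mem _ _ hi]
      refine deviation_congr fun he => ?_
      have : i.1 ≠ d := fun h => hdJ (by rwa [he, h] at hi)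
      simpa using this
    · rw [splice_of_notMem _ _ hi]
      refine deviation_congr fun he => ?_
      have : i.1 ≠ u := fun h => hi (by rwa [he, h])
      simp [this]
  · intro hdJ
    by_contra hu
    refine h1 ?_
    convert hJ _ h2 _ h0
    funext i
    by_cases hi : i ∈ J
    · rw [splice_of_mem _ _ hi]
      refine deviation_congr fun he => ?_
      have : i.1 ≠ u := fun h => hu (by rwa [he, h] at hi)
      simp [this]
    · rw [splice_of_notMem _ _ hi]
      refine deviation_congr fun he => ?_
      have : i.1 ≠ d := fun h => hi (by rwa [he, h])
      simpa using this

theorem refIndex_mem_iff_of_adj [∀ v, Nontrivial (Val v)] {J : Set (G.Index Val)}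
    (hJ : Disintegrates J (G.jointVar Val Z ⁻¹' {Z.domRestrict x})) {u v : V} (huv : G.Adj u v)
    (hu : u ∉ Z) (hv : v ∈ G.ancestors Z) :
    G.refIndex x u ∈ J ↔ G.refIndex x v ∈ J := by
  obtain ⟨d, hd, hvd⟩ := exists_edgeOff_of_mem_ancestors hv
  rw [refIndex_mem_iff_of_disintegrates hJ hvd hd]
  exact refIndex_mem_iff_of_disintegrates hJ (.head ⟨hu, huv⟩ hvd) hd

theorem Relevant.refIndex_mem_history [∀ v, Nontrivial (Val v)] {A : Set V} {v : V}
    (h : G.Relevant A Z v) (x : ∀ v, Val v) :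
    G.refIndex x v ∈ history (G.jointVar Val A) (G.jointVar Val Z ⁻¹' {Z.domRestrict x}) := by
  intro J hJ
  -- a relevant node without descendants in `Z` is reached from `A` through parents only
  suffices G.refIndex x v ∈ J ∧ (v ∈ G.ancestors Z ∨
      ∃ a ∈ A, a ∉ Z ∧ Relation.ReflTransGen (G.EdgeOff Z) v a) from this.1
  induction h with
  | base hA hZ => exact ⟨refIndex_mem_of_generates hJ .refl hA hZ, Or.inr ⟨_, hA, hZ, .refl⟩⟩
  | up _ huv hu ih =>
    rcases ih with ⟨hv, hanc | ⟨a, ha, haZ, hva⟩⟩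
    · exact ⟨(refIndex_mem_iff_of_adj hJ.2 huv hu hanc).2 hv,
        Or.inl (mem_ancestors_of_adj huv hanc)⟩
    · have hua := Relation.ReflTransGen.head ⟨hu, huv⟩ hva
      exact ⟨refIndex_mem_of_generates hJ hua ha haZ, Or.inr ⟨a, ha, haZ, hua⟩⟩
  | down _ hv hvw hw ih =>
    exact ⟨(refIndex_mem_iff_of_adj hJ.2 hvw hv hw).1 ih.1, Or.inl hw⟩

end Deviation

end DAG

theorem mainTheorem3 {V : Type*} [Finite V] (G : DAG V) (Val : V → Type*)
    [∀ v, Finite (Val v)] [∀ v, Nontrivial (Val v)] (V₁ V₂ V₃ : Set V) :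
    G.DSeparated V₁ V₂ V₃ ↔
      FactoredSpace.StructIndep (G.jointVar Val V₁) (G.jointVar Val V₂) (G.jointVar Val V₃) := by
  rw [DAG.dSeparated_iff]
  constructor
  · intro h z
    refine Set.eq_empty_of_forall_notMem fun i hi => h i.1 ?_ ?_
    · exact hi.1 _ (DAG.generates_relevant V₁ V₃ z)
    · exact hi.2 _ (DAG.generates_relevant V₂ V₃ z)
  · intro h v h₁ h₂
    let x : ∀ v, Val v := fun v => Classical.arbitrary (Val v)
    have := h (V₃.domRestrict x)
    exact Set.eq_empty_iff_forall_notMem.1 this _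
      ⟨h₁.refIndex_mem_history x, h₂.refIndex_mem_history x⟩
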